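/- Let $\mathcal X\subseteq\mathbb R^n$, let $\mathcal U\subseteq\mathbb R^m$ be nonempty and compact, both with their Borel $\sigma$-algebras, and let $T(\cdot\mid x,u)$, $(x,u)\in\mathcal X\times\mathcal U$, be a Borel-measurable stochastic kernel on $\mathcal X$. A Markov policy is a sequence $\pi=(\mu_0,\mu_1,\dots)$ of universally measurable maps $\mu_k:\mathcal X\to\mathcal U$; let $\Pi$ be the set of Markov policies. Let $A\subseteq\mathcal X$ be Borel and $N\in\mathbb N$. For $\pi\in\Pi$, $0\le k\le N$ and $x\in\mathcal X$ let $P(x_{k:N}\in A\mid x,\pi)$ be the probability that $x_j\in A$ for all $k\le j\le N$, where $x_k=x$ and $x_{j+1}\sim T(\cdot\mid x_j,\mu_j(x_j))$ for $k\le j<N$. Put $$V^{\uparrow}_k(x)=\sup_{\pi\in\Pi}P(x_{k:N}\in A\mid x,\pi),\qquad V^{\downarrow}_k(x)=\inf_{\pi\in\Pi}P(x_{k:N}\in A\mid x,\pi).$$ Assume that for all $0\le k\le N-1$, $x\in\mathcal X$ and $\lambda\in\mathbb R$ the two sets $$\Big\{u\in\mathcal U:\int_{\mathcal X}V^{\uparrow}_{k+1}(y)\,T(dy\mid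 x,u)\ge\lambda\Big\},\qquad \Big\{u\in\mathcal U:\int_{\mathcal X}V^{\downarrow}_{k+1}(y)\,T(dy\mid x,u)\le\lambda\Big\}$$ are compact. Then for all $0\le k\le N$ and $x\in\mathcal X$ the supremum and the infimum over $\Pi$ defining $V^{\uparrow}_k(x)$ and $V^{\downarrow}_k(x)$ are attained, $V^{\uparrow}_{k+1}$ and $V^{\downarrow}_{k+1}$ are integrable with respect to $T(\cdot\mid x,u)$ for all $0\le k\le N-1$, $x\in\mathcal X$, $u\in\mathcal U$, and the following recursions hold for all $x\in\mathcal X$ and $0\le k\le N-1$, where the maxima and minima over $u$ are attained: $$V^{\uparrow}_N(x)=\mathbb 1_A(x),\qquad V^{\uparrow}_k(x)=\max_{u\in\mathcal U}\ \mathbb 1_A(x)\int_{\mathcal X}V^{\uparrow}_{k+1}(y)\,T(dy\mid x,u),$$ $$V^{\downarrow}_N(x)=\mathbb 1_A(x),\qquad V^{\downarrow}_k(x)=\min_{u\in\mathcal U}\ \mathbb 1_A(x)\int_{\mathcal X}V^{\downarrow}_{k+1}(y)\,T(dy\mid x,u).$$ -/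

import Mathlib

open MeasureTheory ProbabilityTheory

namespace StochSafety

/-- `f` is universally measurable: the preimage of every measurable set belongs to the completion
of the σ-algebra of `α` with respect to every probability measure on `α`. -/
def UniversallyMeasurable {α β : Type*} [MeasurableSpace α] [MeasurableSpace β]
    (f : α → β) : Prop :=
  ∀ μ : Measure α, IsProbabilityMeasure μ → NullMeasurable f μ

/-- A Markov policy: a sequence `μ₀, μ₁, …` of universally measurable maps from states to
actions. -/
abbrev Policy (X U : Type*) [MeasurableSpace X] [MeasurableSpace U] : Type _ :=
  ℕ → {f : X → U // UniversallyMeasurable f}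

section

variable {X U : Type*} [MeasurableSpace X] [MeasurableSpace U]

/-- The joint law of the states `(x_k, …, x_{k+m})` when `x_k = x` and
`x_{j+1} ∼ T(· | x_j, μ_j(x_j))` for `j = k, …, k+m-1`. -/
noncomputable def trajLaw (T : Kernel (X × U) X) (π : Policy X U) (k : ℕ) (x : X) :
    (m : ℕ) → Measure (Fin (m + 1) → X)
  | 0 => Measure.dirac (fun _ => x)
  | m + 1 => (trajLaw T π k x m).bind fun h =>
      (T (h (Fin.last m), (π (k + m)).1 (h (Fin.last m)))).map
        (fun y => (Fin.snoc h y : Fin (m + 1 + 1) → X))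

/-- `V_k^π(x) = P(x_{k:N} ∈ A | x_k = x, π)`, meant for `k ≤ N`. -/
noncomputable def safeProb (T : Kernel (X × U) X) (A : Set X) (N : ℕ) (π : Policy X U)
    (k : ℕ) (x : X) : ℝ :=
  (trajLaw T π k x (N - k)).real {h | ∀ i, h i ∈ A}

/-- The maximum invariance value function. -/
noncomputable def maxInv (T : Kernel (X × U) X) (A : Set X) (N k : ℕ) (x : X) : ℝ :=
  ⨆ π : Policy X U, safeProb T A N π k x

/-- The minimum invariance value function. -/
noncomputable def minInv (T : Kernel (X × U) X) (A : Set X) (N k : ℕ) (x : X) : ℝ :=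
  ⨅ π : Policy X U, safeProb T A N π k x

/-- The attainability assumption. -/
def Attainable [TopologicalSpace U] (T : Kernel (X × U) X) (A : Set X) (N : ℕ) : Prop :=
  ∀ k < N, ∀ (x : X) (r : ℝ),
    IsCompact {u : U | r ≤ ∫ y, maxInv T A N (k + 1) y ∂(T (x, u))} ∧
    IsCompact {u : U | ∫ y, minInv T A N (k + 1) y ∂(T (x, u)) ≤ r}

theorem measurable_snoc (m : ℕ) :
    Measurable (fun p : (Fin (m + 1) → X) × X => (Fin.snoc p.1 p.2 : Fin (m + 1 + 1) → X)) := by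
  refine measurable_pi_lambda _ fun i => ?_
  refine Fin.lastCases ?_ (fun j => ?_) i
  · simpa using measurable_snd
  · simpa [Function.comp_def] using
      (measurable_pi_apply (X := fun _ : Fin (m + 1) => X) j).comp measurable_fst

/-- One step of the trajectory is an a.e. measurable function of the past, so the `bind` in
`trajLaw` is the genuine mixture of measures. -/
theorem aemeasurable_step [TopologicalSpace U] [SecondCountableTopology U]
    [TopologicalSpace.PseudoMetrizableSpace U] [BorelSpace U] [Nonempty U]
    (T : Kernel (X × U) X) [IsMarkovKernel T] (f : {f : X → U // UniversallyMeasurable f})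
    (m : ℕ) (P : Measure (Fin (m + 1) → X)) [IsProbabilityMeasure P] :
    AEMeasurable (fun h => (T (h (Fin.last m), f.1 (h (Fin.last m)))).map
        (fun y => (Fin.snoc h y : Fin (m + 1 + 1) → X))) P := by
  have hl : Measurable (fun h : Fin (m + 1) → X => h (Fin.last m)) := measurable_pi_apply _
  have hp : IsProbabilityMeasure (P.map fun h => h (Fin.last m)) :=
    Measure.isProbabilityMeasure_map hl.aemeasurable
  obtain ⟨g, hg, hfg⟩ := (f.2 _ hp).aemeasurable
  have hfg' := ae_of_ae_map hl.aemeasurable hfg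
  let κ : Kernel (Fin (m + 1) → X) X :=
    T.comap (fun h => (h (Fin.last m), g (h (Fin.last m)))) (hl.prodMk (hg.comp hl))
  refine ⟨fun h => ((Kernel.id ×ₖ κ).map
    (fun p : (Fin (m + 1) → X) × X => (Fin.snoc p.1 p.2 : Fin (m + 1 + 1) → X))) h,
    Kernel.measurable _, ?_⟩
  filter_upwards [hfg'] with h hh
  rw [Kernel.map_apply _ (measurable_snoc m), Kernel.prod_apply, Kernel.id_apply,
    Measure.dirac_prod, Measure.map_map (measurable_snoc m) (by fun_prop)]
  simp only [κ, Kernel.comap_apply, hh]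
  rfl

theorem isProbabilityMeasure_trajLaw [TopologicalSpace U] [SecondCountableTopology U]
    [TopologicalSpace.PseudoMetrizableSpace U] [BorelSpace U] [Nonempty U]
    (T : Kernel (X × U) X) [IsMarkovKernel T] (π : Policy X U) (k : ℕ) (x : X) (m : ℕ) :
    IsProbabilityMeasure (trajLaw T π k x m) := by
  induction m with
  | zero => rw [trajLaw]; infer_instance
  | succ m ih =>
    rw [trajLaw]
    refine isProbabilityMeasure_bind (aemeasurable_step T (π (k + m)) m _) ?_
    refine Filter.Eventually.of_forall fun h => ?_
    exact Measure.isProbabilityMeasure_map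
      ((measurable_snoc m).comp (measurable_const.prodMk measurable_id)).aemeasurable

end

end StochSafety

/-! The functions `maxVal` and `minVal` iterate the one-step optimum. The difficulty is
measurability: an optimum of Borel functions over actions need not be Borel. The class that survives
is that of functions with Souslin strict hypograph (`V` for the maximum, `1 - V` for the minimum).
Optimizing over actions is a projection (`IsUpperSouslin.of_isGreatest`), integrating against `T`
measures the Souslin region under the graph (`IsUpperSouslin.integral_kernel`), and Souslin sets are
null measurable, so the integrals make sense. Since `X` is an arbitrary subset, possibly not
standard Borel, its Souslin sets are studied as preimages of analytic subsets of Cantor space.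

The rest is a verification argument. For the maximum, the expectation of the candidate at the
current state, on the event of having stayed in `A` (`stageValue`), is nonincreasing in time under
every policy and nondecreasing under a policy that picks maximizers almost surely; it starts at the
candidate and ends at `safeProb`. The minimum is dual. Attainment concerns one fixed starting pair
`(k, x)`, so each map need only be optimal almost surely for the law of the current state, and Borel
selectors suffice (`exists_policy_ae`).

The compactness hypothesis speaks of `maxInv` and `minInv`, not of the iterates. Hence `maxVal_spec`
and `minVal_spec` use strong induction on the number of steps to go: identification at earlier
stages makes the next optimum attained. -/

namespace StochSafety

open Set Filter Topology
open scoped ENNReal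

/-! ### Souslin sets: measurability for completed measures, stability, and measure under a kernel.
-/

section Souslin

/-- A function of a point and a sequence that depends only on finitely many terms of the sequence
is jointly measurable as soon as it is measurable in the point. -/
theorem measurable_of_prefix {Ω β : Type*} [MeasurableSpace Ω] [MeasurableSpace β] (n : ℕ)
    {f : Ω → (ℕ → ℕ) → β} (hf : ∀ σ, Measurable fun ω => f ω σ)
    (hc : ∀ ω σ τ, (∀ i < n, σ i = τ i) → f ω σ = f ω τ) :
    Measurable fun p : Ω × (ℕ → ℕ) => f p.1 p.2 := by
  let ext : (Fin n → ℕ) → ℕ → ℕ := fun a i => if h : i < n then a ⟨i, h⟩ else 0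
  have hg : Measurable fun q : Ω × (Fin n → ℕ) => f q.1 (ext q.2) :=
    measurable_from_prod_countable_left fun a => hf (ext a)
  have hr : Measurable fun p : Ω × (ℕ → ℕ) => (p.1, fun i : Fin n => p.2 i) := by fun_prop
  convert hg.comp hr using 1
  funext p
  exact hc _ _ _ fun i hi => by simp [ext, hi]

/-- Measurable choice of an infinite branch, one term at a time. -/
theorem exists_measurable_branch {Ω : Type*} [MeasurableSpace Ω] {P : ℕ → Ω → (ℕ → ℕ) → Prop}
    (hm : ∀ n σ, Measurable fun ω => P n ω σ)
    (hc : ∀ n ω σ τ, (∀ i < n, σ i = τ i) → P n ω σ → P n ω τ)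
    (hs : ∀ n ω σ, P n ω σ → ∃ k, P (n + 1) ω (Function.update σ n k)) :
    ∃ s : Ω → ℕ → ℕ, Measurable s ∧ ∀ ω, P 0 ω 0 → ∀ n, P n ω (s ω) := by
  classical
  have hjoint : ∀ n, Measurable fun p : Ω × (ℕ → ℕ) => P n p.1 p.2 := fun n =>
    measurable_of_prefix n (hm n) fun ω σ τ h =>
      propext ⟨hc n ω σ τ h, hc n ω τ σ fun i hi => (h i hi).symm⟩
  -- The second alternative makes the search succeed everywhere, so the least extension is a total
  -- measurable function; it is ruled out along live branches.
  have hex : ∀ n (p : Ω × (ℕ → ℕ)), ∃ k, P (n + 1) p.1 (Function.update p.2 n k) ∨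
      ∀ i, ¬ P (n + 1) p.1 (Function.update p.2 n i) := by
    intro n p
    by_cases h : ∃ k, P (n + 1) p.1 (Function.update p.2 n k)
    · exact h.imp fun _ => Or.inl
    · exact ⟨0, Or.inr (not_exists.1 h)⟩
  have hupd : ∀ n k, Measurable fun p : Ω × (ℕ → ℕ) => (p.1, Function.update p.2 n k) := by
    intro n k
    refine measurable_fst.prodMk (measurable_pi_lambda _ fun i => ?_)
    by_cases h : i = n
    · subst h; simp
    · simpa [h, Function.comp_def] using (measurable_pi_apply i).comp measurable_snd
  let next : ℕ → Ω × (ℕ → ℕ) → ℕ := fun n p => Nat.find (hex n p)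
  have hnext : ∀ n, Measurable (next n) := by
    intro n
    refine measurable_find _ fun k => ?_
    refine MeasurableSet.union ?_ ?_
    · exact measurableSet_setOfPred.2 ((hjoint (n + 1)).comp (hupd n k))
    · exact measurableSet_setOfPred.2
        (Measurable.forall fun i => ((hjoint (n + 1)).comp (hupd n i)).not)
  let t : ℕ → Ω → ℕ → ℕ := fun n => Nat.rec (fun _ => 0)
    (fun n f ω => Function.update (f ω) n (next n (ω, f ω))) n
  have ht : ∀ n ω, t (n + 1) ω = Function.update (t n ω) n (next n (ω, t n ω)) :=
    fun _ _ => rfl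
  have htm : ∀ n, Measurable (t n) := by
    intro n
    induction n with
    | zero => exact measurable_const
    | succ n ih =>
      refine measurable_pi_lambda _ fun i => ?_
      simp only [ht]
      by_cases h : i = n
      · subst h
        simpa [Function.comp_def] using (hnext i).comp (measurable_id.prodMk ih)
      · simpa [h, Function.comp_def] using (measurable_pi_apply i).comp ih
  have hst : ∀ n ω, ∀ i < n, t n ω i = t (i + 1) ω i := by
    intro n ω i hi
    induction n with
    | zero => omega
    | succ n ih =>
      rcases Nat.lt_succ_iff_lt_or_eq.1 hi with h | rfl
      · rw [ht, Function.update_of_ne h.ne, ih h]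
      · rfl
  refine ⟨fun ω n => t (n + 1) ω n,
    measurable_pi_lambda _ fun n => (measurable_pi_apply n).comp (htm (n + 1)), ?_⟩
  intro ω h0 n
  refine hc n ω (t n ω) _ (hst n ω) ?_
  induction n with
  | zero => exact h0
  | succ n ih =>
    rw [ht]
    rcases Nat.find_spec (hex n (ω, t n ω)) with h | h
    · exact h
    · obtain ⟨k, hk⟩ := hs n ω _ ih
      exact absurd hk (h k)

variable {P : Type*}

/-- The closed outer approximations of the image of the compact set of sequences bounded by `σ`. -/
def outerApprox [TopologicalSpace P] (h : (ℕ → ℕ) → P) (σ : ℕ → ℕ) (n : ℕ) : Set P :=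
  closure (h '' {τ | ∀ i < n, τ i ≤ σ i})

theorem outerApprox_congr [TopologicalSpace P] (h : (ℕ → ℕ) → P) {σ τ : ℕ → ℕ} {n : ℕ}
    (hc : ∀ i < n, σ i = τ i) : outerApprox h σ n = outerApprox h τ n := by
  have : {ρ : ℕ → ℕ | ∀ i < n, ρ i ≤ σ i} = {ρ | ∀ i < n, ρ i ≤ τ i} := by
    ext ρ
    exact forall₂_congr fun i hi => by rw [hc i hi]
  rw [outerApprox, this, outerApprox]

/-- Compactness of the box of sequences below `σ`: near-preimages bounded on longer and longer
prefixes have a convergent subsequence, and continuity sends its limit to the given point. -/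
theorem iInter_outerApprox_subset [TopologicalSpace P] [TopologicalSpace.MetrizableSpace P]
    {h : (ℕ → ℕ) → P} (hh : Continuous h) (σ : ℕ → ℕ) :
    ⋂ n, outerApprox h σ n ⊆ range h := by
  let _ := TopologicalSpace.metrizableSpaceMetric P
  intro y hy
  have hex : ∀ n : ℕ, ∃ τ : ℕ → ℕ, (∀ i < n, τ i ≤ σ i) ∧ dist y (h τ) < 1 / ((n : ℝ) + 1) := by
    intro n
    obtain ⟨_, ⟨τ, hτ, rfl⟩, hd⟩ :=
      Metric.mem_closure_iff.1 (mem_iInter.1 hy n) (1 / ((n : ℝ) + 1)) (by positivity)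
    exact ⟨τ, hτ, hd⟩
  choose τ hτ hd using hex
  have hK : IsCompact (Set.pi univ fun i : ℕ => Set.Iic (σ i)) :=
    isCompact_univ_pi fun i => (Set.finite_Iic (σ i)).isCompact
  -- Only the first `n` terms of `τ n` are bounded; truncation puts it in the box and changes no
  -- fixed coordinate once `n` is large.
  obtain ⟨ρ, -, φ, hφ, hρ⟩ := hK.tendsto_subseq (x := fun n i => min (τ n i) (σ i))
    fun n i _ => Set.mem_Iic.2 (min_le_right _ _)
  have hlim : Tendsto (τ ∘ φ) atTop (𝓝 ρ) := by
    rw [tendsto_pi_nhds] at hρ ⊢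
    intro i
    refine (hρ i).congr' ?_
    filter_upwards [eventually_gt_atTop i] with n hn
    exact min_eq_left (hτ (φ n) i (hn.trans_le (hφ.id_le n)))
  have h1 : Tendsto (fun n => h (τ (φ n))) atTop (𝓝 (h ρ)) := (hh.tendsto ρ).comp hlim
  have h2 : Tendsto (fun n => h (τ n)) atTop (𝓝 y) := by
    rw [tendsto_iff_dist_tendsto_zero]
    refine squeeze_zero (fun _ => dist_nonneg) (fun n => ?_)
      tendsto_one_div_add_atTop_nhds_zero_nat
    rw [dist_comm]
    exact (hd n).le
  exact ⟨ρ, tendsto_nhds_unique h1 (h2.comp hφ.tendsto_atTop)⟩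

theorem measurableSet_outerApprox [TopologicalSpace P] [MeasurableSpace P] [BorelSpace P]
    (h : (ℕ → ℕ) → P) (σ : ℕ → ℕ) (n : ℕ) : MeasurableSet (outerApprox h σ n) :=
  isClosed_closure.measurableSet

theorem antitone_outerApprox [TopologicalSpace P] (h : (ℕ → ℕ) → P) (σ : ℕ → ℕ) :
    Antitone (outerApprox h σ) := fun _ _ hmn =>
  closure_mono (image_mono fun _ hτ i hi => hτ i (hi.trans_le hmn))

theorem measure_iInter_outerApprox [TopologicalSpace P] [MeasurableSpace P] [BorelSpace P]
    (μ : Measure P) [IsFiniteMeasure μ] (h : (ℕ → ℕ) → P) (σ : ℕ → ℕ) :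
    μ (⋂ n, outerApprox h σ n) = ⨅ n, μ (outerApprox h σ n) :=
  (antitone_outerApprox h σ).measure_iInter
    (fun n => (measurableSet_outerApprox h σ n).nullMeasurableSet) ⟨0, measure_ne_top _ _⟩

/-- Outer measure is continuous along arbitrary increasing unions, so the coordinates can be bounded
one after another while the image keeps outer measure above `r`. -/
theorem exists_le_measure_outerApprox [TopologicalSpace P] [MeasurableSpace P]
    (μ : Measure P) (h : (ℕ → ℕ) → P) {r : ℝ≥0∞} (hr : r < μ (range h)) :
    ∃ σ, ∀ n, r ≤ μ (outerApprox h σ n) := by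
  obtain ⟨s, -, hs⟩ := exists_measurable_branch (Ω := Unit)
    (P := fun n _ σ => r < μ (h '' {τ | ∀ i < n, τ i ≤ σ i})) (fun _ _ => measurable_of_finite _)
    (fun n _ σ τ hc hlt => by
      have : {ρ : ℕ → ℕ | ∀ i < n, ρ i ≤ σ i} = {ρ | ∀ i < n, ρ i ≤ τ i} := by
        ext ρ
        exact forall₂_congr fun i hi => by rw [hc i hi]
      rwa [this] at hlt)
    (fun n _ σ hlt => by
      have hmono : Monotone fun k =>
          h '' {τ : ℕ → ℕ | ∀ i < n + 1, τ i ≤ Function.update σ n k i} := by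
        refine fun k l hkl => image_mono fun τ hτ i hi => (hτ i hi).trans ?_
        exact Function.update_mono hkl i
      have hU : h '' {τ | ∀ i < n, τ i ≤ σ i} ⊆
          ⋃ k, h '' {τ : ℕ → ℕ | ∀ i < n + 1, τ i ≤ Function.update σ n k i} := by
        rintro _ ⟨τ, hτ, rfl⟩
        refine mem_iUnion.2 ⟨τ n, τ, fun i hi => ?_, rfl⟩
        rcases Nat.lt_succ_iff_lt_or_eq.1 hi with h | rfl
        · rw [Function.update_of_ne h.ne]; exact hτ i h
        · simp
      have := hlt.trans_le (measure_mono hU)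
      rw [hmono.measure_iUnion] at this
      exact lt_iSup_iff.1 this)
  refine ⟨s (), fun n => ((hs () ?_ n).le).trans (measure_mono subset_closure)⟩
  simpa using hr

/-- Continuous images of the Baire space are measurable for the completion of every finite
measure. -/
theorem nullMeasurableSet_range [TopologicalSpace P] [TopologicalSpace.MetrizableSpace P]
    [MeasurableSpace P] [BorelSpace P] (μ : Measure P) [IsFiniteMeasure μ]
    {h : (ℕ → ℕ) → P} (hh : Continuous h) : NullMeasurableSet (range h) μ := by
  rcases eq_or_ne (μ (range h)) 0 with h0 | h0
  · exact .of_null h0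
  obtain ⟨u, -, hu, hlim⟩ := exists_seq_strictMono_tendsto' (pos_iff_ne_zero.2 h0)
  choose σ hσ using fun k => exists_le_measure_outerApprox μ h (hu k).2
  let C : Set P := ⋃ k, ⋂ n, outerApprox h (σ k) n
  have hC : MeasurableSet C :=
    .iUnion fun k => .iInter fun n => measurableSet_outerApprox h (σ k) n
  have hsub : C ⊆ range h := iUnion_subset fun k => iInter_outerApprox_subset hh (σ k)
  have hle : μ (range h) ≤ μ C := by
    refine le_of_tendsto' hlim fun k => ?_
    refine le_trans ?_ (measure_mono (subset_iUnion _ k))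
    rw [measure_iInter_outerApprox]
    exact le_iInf (hσ k)
  have : C =ᵐ[μ] range h :=
    ae_eq_of_subset_of_measure_ge hsub hle hC.nullMeasurableSet (measure_ne_top _ _)
  exact hC.nullMeasurableSet.congr this

variable {Z W : Type*} [MeasurableSpace Z] [MeasurableSpace W]

/-- A Souslin set: the projection of a measurable set along the Baire space. -/
def IsSouslin (S : Set Z) : Prop :=
  ∃ B : Set (Z × (ℕ → ℕ)), MeasurableSet B ∧ S = {z | ∃ σ, (z, σ) ∈ B}

theorem _root_.MeasurableSet.isSouslin {S : Set Z} (hS : MeasurableSet S) : IsSouslin S :=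
  ⟨Prod.fst ⁻¹' S, measurable_fst hS, by simp⟩

theorem IsSouslin.preimage {S : Set W} (hS : IsSouslin S) {f : Z → W} (hf : Measurable f) :
    IsSouslin (f ⁻¹' S) := by
  obtain ⟨B, hB, rfl⟩ := hS
  exact ⟨Prod.map f id ⁻¹' B, hf.prodMap measurable_id hB, rfl⟩

/-- A nonempty Polish space is a continuous image of the Baire space, which can therefore replace it
as parameter space. -/
theorem isSouslin_of_standardBorel [StandardBorelSpace W] [Nonempty W] {B : Set (Z × W)}
    (hB : MeasurableSet B) : IsSouslin {z | ∃ w, (z, w) ∈ B} := by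
  let _ := upgradeStandardBorel W
  obtain ⟨f, hf, hsurj⟩ := PolishSpace.exists_nat_nat_continuous_surjective W
  refine ⟨Prod.map id f ⁻¹' B, measurable_id.prodMap hf.measurable hB, ?_⟩
  ext z
  exact hsurj.exists

theorem IsSouslin.proj [StandardBorelSpace W] [Nonempty W] {S : Set (Z × W)}
    (hS : IsSouslin S) : IsSouslin {z | ∃ w, (z, w) ∈ S} := by
  obtain ⟨B, hB, rfl⟩ := hS
  convert isSouslin_of_standardBorel (W := W × (ℕ → ℕ))
    (B := MeasurableEquiv.prodAssoc.symm ⁻¹' B) (MeasurableEquiv.prodAssoc.symm.measurable hB)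
    using 1
  ext z
  simp [MeasurableEquiv.prodAssoc]

theorem IsSouslin.iInter {ι : Type*} [Countable ι] {S : ι → Set Z} (hS : ∀ i, IsSouslin (S i)) :
    IsSouslin (⋂ i, S i) := by
  choose B hB hSB using hS
  have : MeasurableSet (⋂ i, (fun p : Z × (ι → ℕ → ℕ) => (p.1, p.2 i)) ⁻¹' B i) :=
    .iInter fun i => (show Measurable fun p : Z × (ι → ℕ → ℕ) => (p.1, p.2 i) by fun_prop) (hB i)
  convert isSouslin_of_standardBorel this using 1
  ext z
  simp [hSB, Classical.skolem]

theorem IsSouslin.inter {S S' : Set Z} (hS : IsSouslin S) (hS' : IsSouslin S') :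
    IsSouslin (S ∩ S') := by
  rw [inter_eq_iInter]
  exact .iInter fun b => by cases b <;> assumption

theorem IsSouslin.union_measurableSet {S S' : Set Z} (hS : IsSouslin S) (hS' : MeasurableSet S') :
    IsSouslin (S ∪ S') := by
  obtain ⟨B, hB, rfl⟩ := hS
  refine ⟨B ∪ Prod.fst ⁻¹' S', hB.union (measurable_fst hS'), ?_⟩
  ext z
  simp [exists_or]

-- The coding records membership in each set of a countable generating sequence, so pulling back
-- coordinates recovers the generators. Points need not be separated.
open MeasurableSpace in
theorem comap_mapNatBool [CountablyGenerated Z] :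
    MeasurableSpace.comap (mapNatBool Z) inferInstance = (inferInstance : MeasurableSpace Z) := by
  refine le_antisymm (measurable_mapNatBool Z).comap_le ?_
  conv_lhs => rw [← generateFrom_natGeneratingSequence Z]
  refine generateFrom_le ?_
  rintro _ ⟨n, rfl⟩
  refine ⟨{y | y n = true}, measurableSet_eq_fun (measurable_pi_apply n) measurable_const, ?_⟩
  ext z
  simp [mapNatBool]

open MeasurableSpace in
theorem exists_preimage_mapNatBool [CountablyGenerated Z] {B : Set (Z × W)}
    (hB : MeasurableSet B) : ∃ B' : Set ((ℕ → Bool) × W), MeasurableSet B' ∧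
      Prod.map (mapNatBool Z) id ⁻¹' B' = B := by
  have h := comap_prodMap (mα := inferInstance) (mβ := ‹MeasurableSpace W›)
    (mapNatBool Z) (id : W → W)
  rw [comap_mapNatBool, MeasurableSpace.comap_id] at h
  have hB' : MeasurableSet[MeasurableSpace.prod (inferInstance : MeasurableSpace Z) ‹_›] B := hB
  rw [← h] at hB'
  exact hB'

-- This transfer removes any need for `Z` to be standard Borel: the defining measurable set descends
-- to Cantor space times Baire space, where Borel sets are analytic.
open MeasurableSpace in
theorem IsSouslin.exists_range [CountablyGenerated Z] {S : Set Z} (hS : IsSouslin S) :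
    S = ∅ ∨ ∃ h : (ℕ → ℕ) → (ℕ → Bool), Continuous h ∧ S = mapNatBool Z ⁻¹' range h := by
  obtain ⟨B, hB, rfl⟩ := hS
  obtain ⟨B', hB', rfl⟩ := exists_preimage_mapNatBool hB
  have : PolishSpace (ℕ → Bool) := ⟨⟩
  have ha := hB'.analyticSet
  rw [AnalyticSet] at ha
  rcases ha with rfl | ⟨h, hh, rfl⟩
  · left; simp
  · right
    refine ⟨fun σ => (h σ).1, continuous_fst.comp hh, ?_⟩
    ext z
    constructor
    · rintro ⟨σ, τ, hτ⟩
      exact ⟨τ, congrArg Prod.fst hτ⟩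
    · rintro ⟨τ, hτ⟩
      exact ⟨(h τ).2, τ, Prod.ext hτ rfl⟩

open MeasurableSpace in
theorem IsSouslin.nullMeasurableSet [CountablyGenerated Z] {S : Set Z} (hS : IsSouslin S)
    (μ : Measure Z) [IsFiniteMeasure μ] : NullMeasurableSet S μ := by
  rcases hS.exists_range with rfl | ⟨h, hh, rfl⟩
  · exact .empty
  · exact (nullMeasurableSet_range (μ.map (mapNatBool Z)) hh).preimage
      ((measurable_mapNatBool Z).measurePreserving μ).quasiMeasurePreserving

open MeasurableSpace in
/-- The strict hypograph of the measure of a Souslin set under a finite kernel is Souslin. -/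
theorem IsSouslin.hypograph_kernel [CountablyGenerated Z] {S : Set Z} (hS : IsSouslin S)
    (κ : Kernel W Z) [IsFiniteKernel κ] :
    IsSouslin {p : W × ℝ | p.2 < (κ p.1 S).toReal} := by
  rcases hS.exists_range with rfl | ⟨h, hh, rfl⟩
  · simp only [measure_empty, ENNReal.toReal_zero]
    exact (measurableSet_lt measurable_snd measurable_const).isSouslin
  let η : Kernel W (ℕ → Bool) := κ.map (mapNatBool Z)
  have hη : ∀ w, η w (range h) = κ w (mapNatBool Z ⁻¹' range h) := by
    intro w
    rw [Kernel.map_apply _ (measurable_mapNatBool Z)]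
    refine Measure.map_apply₀ (measurable_mapNatBool Z).aemeasurable ?_
    exact nullMeasurableSet_range _ hh
  have hm : ∀ n, Measurable fun q : W × (ℕ → ℕ) => η q.1 (outerApprox h q.2 n) := fun n =>
    measurable_of_prefix (f := fun w σ => η w (outerApprox h σ n)) n
      (fun σ => η.measurable_coe (measurableSet_outerApprox h σ n))
      fun w σ τ hc => by rw [outerApprox_congr h hc]
  -- Inner approximation: the measure exceeds `t` exactly when that of the piece given by some `σ`
  -- does. This is jointly measurable, as the `n`-th approximation sees only `n` terms of `σ`.
  refine ⟨{q : (W × ℝ) × (ℕ → ℕ) | q.1.2 < (⨅ n, η q.1.1 (outerApprox h q.2 n)).toReal}, ?_, ?_⟩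
  · refine measurableSet_lt (by fun_prop) (Measurable.ennreal_toReal (.iInf fun n => ?_))
    exact (hm n).comp (by fun_prop : Measurable fun q : (W × ℝ) × (ℕ → ℕ) => (q.1.1, q.2))
  · ext ⟨w, t⟩
    simp only [mem_ofPred_eq, ← hη, ← measure_iInter_outerApprox]
    constructor
    · intro ht
      rcases lt_or_ge t 0 with h0 | h0
      · exact ⟨0, h0.trans_le ENNReal.toReal_nonneg⟩
      obtain ⟨r, hr1, hr2⟩ := exists_between ht
      obtain ⟨σ, hσ⟩ := exists_le_measure_outerApprox (η w) h (r := ENNReal.ofReal r)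
        ((ENNReal.ofReal_lt_iff_lt_toReal (h0.trans hr1.le) (measure_ne_top _ _)).2 hr2)
      refine ⟨σ, hr1.trans_le ?_⟩
      rw [measure_iInter_outerApprox,
        ← ENNReal.ofReal_le_iff_le_toReal (ne_top_of_le_ne_top (measure_ne_top (η w) (outerApprox h σ 0)) (iInf_le _ 0))]
      exact le_iInf hσ
    · rintro ⟨σ, hσ⟩
      exact hσ.trans_le (ENNReal.toReal_mono (measure_ne_top _ _)
        (measure_mono (iInter_outerApprox_subset hh σ)))

end Souslin

/-! ### Measurable selection and upper Souslin functions. -/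

section Selection

variable {Z W : Type*} [MeasurableSpace Z] [MeasurableSpace W]

open MeasurableSpace in
/-- **Jankov–von Neumann selection**, up to a null set of a given finite measure. -/
theorem IsSouslin.exists_selector [CountablyGenerated Z] [StandardBorelSpace W] [Nonempty W]
    {S : Set (Z × W)} (hS : IsSouslin S) (ν : Measure Z) [IsFiniteMeasure ν]
    (hne : ∀ᵐ z ∂ν, ∃ w, (z, w) ∈ S) :
    ∃ f : Z → W, Measurable f ∧ ∀ᵐ z ∂ν, (z, f z) ∈ S := by
  obtain ⟨B, hB, rfl⟩ := hS
  obtain ⟨B', hB', hBB'⟩ := exists_preimage_mapNatBool (W := W × (ℕ → ℕ))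
    (MeasurableEquiv.prodAssoc.symm.measurable hB)
  have hmem : ∀ z w σ, (mapNatBool Z z, w, σ) ∈ B' ↔ ((z, w), σ) ∈ B := fun z w σ =>
    Set.ext_iff.1 hBB' (z, w, σ)
  have : PolishSpace (ℕ → Bool) := ⟨⟩
  let _ := upgradeStandardBorel W
  have ha := hB'.analyticSet
  rw [AnalyticSet] at ha
  rcases ha with rfl | ⟨h, hh, rfl⟩
  · refine ⟨fun _ => Classical.arbitrary W, measurable_const, ?_⟩
    filter_upwards [hne] with z ⟨w, σ, hσ⟩
    exact absurd ((hmem z w σ).2 hσ) (notMem_empty _)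
  have hh1 : Continuous fun τ => (h τ).1 := continuous_fst.comp hh
  -- A prefix is kept while it extends to a point of the fibre. The sets where this holds are
  -- preimages of analytic sets, so the branch is built over the completed σ-algebra and later
  -- replaced by a Borel version.
  obtain ⟨s, hs, hsP⟩ := exists_measurable_branch (Ω := NullMeasurableSpace Z ν)
    (P := fun n z σ => ∃ τ : ℕ → ℕ, (∀ i < n, σ i = τ i) ∧ (h τ).1 = mapNatBool Z z)
    (fun n σ => by
      let c : (ℕ → ℕ) → ℕ → ℕ := fun τ i => if i < n then σ i else τ i
      have hc : Continuous c := continuous_pi fun i => by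
        by_cases hi : i < n
        · simpa [c, hi] using continuous_const
        · simpa [c, hi] using continuous_apply i
      have hnull := (nullMeasurableSet_range (ν.map (mapNatBool Z)) (hh1.comp hc)).preimage
        ((measurable_mapNatBool Z).measurePreserving ν).quasiMeasurePreserving
      refine measurableSet_setOfPred.1 ?_
      change NullMeasurableSet {z : Z | _} ν
      refine cast (congrArg (fun s => NullMeasurableSet s ν) (Set.ext fun z => Iff.symm ?_)) hnull
      constructor
      · rintro ⟨τ, hτ, hz⟩
        refine ⟨τ, ?_⟩
        have : c τ = τ := by
          funext i
          by_cases hi : i < n <;> simp [c, hi, hτ]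
        simpa [this] using hz
      · rintro ⟨τ, hz⟩
        exact ⟨c τ, fun i hi => by simp [c, hi], hz⟩)
    (fun n z σ τ hc ⟨ρ, hρ, hz⟩ => ⟨ρ, fun i hi => (hc i hi).symm.trans (hρ i hi), hz⟩)
    (fun n z σ ⟨ρ, hρ, hz⟩ => ⟨ρ n, ρ, fun i hi => by
      rcases Nat.lt_succ_iff_lt_or_eq.1 hi with h | rfl
      · rw [Function.update_of_ne h.ne, hρ i h]
      · simp, hz⟩)
  have hs' : NullMeasurable (fun z : Z => s z) ν := fun t ht => hs ht
  obtain ⟨s', hs'm, hss'⟩ := hs'.aemeasurable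
  refine ⟨fun z => (h (s' z)).2.1, (measurable_fst.comp measurable_snd).comp
    (hh.measurable.comp hs'm), ?_⟩
  filter_upwards [hne, hss'] with z ⟨w, σ, hσ⟩ hz
  obtain ⟨τ, hτ⟩ := (hmem z w σ).2 hσ
  have hP := hsP z ⟨τ, by simp, congrArg Prod.fst hτ⟩
  choose ρ hρ hρz using hP
  have hlim : Tendsto ρ atTop (𝓝 (s z)) := by
    rw [tendsto_pi_nhds]
    intro i
    refine tendsto_const_nhds.congr' ?_
    filter_upwards [eventually_gt_atTop i] with n hn
    exact hρ n i hn
  -- The fibre is closed and contains sequences agreeing with `s z` on ever longer prefixes, hence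
  -- contains `s z`.
  have heq : (h (s z)).1 = mapNatBool Z z := by
    refine tendsto_nhds_unique ((hh1.tendsto _).comp hlim) ?_
    simp only [Function.comp_def, hρz]
    exact tendsto_const_nhds
  refine ⟨(h (s' z)).2.2, (hmem _ _ _).1 ⟨s' z, Prod.ext ?_ rfl⟩⟩
  rw [← heq, ← hz]

/-- A function is upper Souslin if its strict hypograph is a Souslin set. -/
def IsUpperSouslin (V : Z → ℝ) : Prop :=
  IsSouslin {p : Z × ℝ | p.2 < V p.1}

theorem _root_.Measurable.isUpperSouslin {V : Z → ℝ} (hV : Measurable V) : IsUpperSouslin V :=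
  (measurableSet_lt measurable_snd (hV.comp measurable_fst)).isSouslin

open MeasurableSpace in
theorem IsUpperSouslin.aemeasurable [CountablyGenerated Z] {V : Z → ℝ} (hV : IsUpperSouslin V)
    (μ : Measure Z) [IsFiniteMeasure μ] : AEMeasurable V μ := by
  have : Measurable fun z : NullMeasurableSpace Z μ => V z := measurable_of_Ioi fun t =>
    (hV.preimage (f := fun z => (z, t)) (by fun_prop)).nullMeasurableSet μ
  exact NullMeasurable.aemeasurable fun s hs => this hs

theorem IsUpperSouslin.isSouslin_lt_comp {V : Z → ℝ} (hV : IsUpperSouslin V) {f : W → Z}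
    (hf : Measurable f) {M : W → ℝ} (hM : Measurable M) : IsSouslin {w | M w < V (f w)} :=
  IsSouslin.preimage (S := {p : Z × ℝ | p.2 < V p.1}) hV (hf.prodMk hM)

/-- Maximization over a standard Borel parameter preserves upper Souslin functions. -/
theorem IsUpperSouslin.of_isGreatest [StandardBorelSpace W] [Nonempty W] {g : Z × W → ℝ}
    (hg : IsUpperSouslin g) {V : Z → ℝ}
    (hV : ∀ z, IsGreatest (range fun w => g (z, w)) (V z)) : IsUpperSouslin V := by
  have h : IsSouslin {q : (Z × ℝ) × W | q.1.2 < g (q.1.1, q.2)} :=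
    hg.isSouslin_lt_comp (f := fun q : (Z × ℝ) × W => (q.1.1, q.2)) (by fun_prop) (by fun_prop)
  refine cast (congrArg IsSouslin (Set.ext fun ⟨z, t⟩ => Iff.symm ?_)) h.proj
  obtain ⟨⟨w, hw⟩, hub⟩ := hV z
  exact ⟨fun ht => ⟨w, ht.trans_eq hw.symm⟩, fun ⟨u, hu⟩ => hu.trans_le (hub ⟨u, rfl⟩)⟩

theorem IsUpperSouslin.ite {V : Z → ℝ} (hV : IsUpperSouslin V) {A : Set Z}
    (hA : MeasurableSet A) [DecidablePred (· ∈ A)] (c : ℝ) :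
    IsUpperSouslin fun z => if z ∈ A then V z else c := by
  have h : IsSouslin ({p : Z × ℝ | p.2 < V p.1} ∩ Prod.fst ⁻¹' A ∪
      Prod.fst ⁻¹' Aᶜ ∩ {p : Z × ℝ | p.2 < c}) :=
    (hV.inter (measurable_fst hA).isSouslin).union_measurableSet
      ((measurable_fst hA.compl).inter (measurableSet_lt measurable_snd measurable_const))
  refine cast (congrArg IsSouslin ?_) h
  ext ⟨z, t⟩
  by_cases hz : z ∈ A <;> simp [hz]

open MeasurableSpace in
/-- Integration against a Markov kernel preserves upper Souslin functions. -/
theorem IsUpperSouslin.integral_kernel [CountablyGenerated Z] {V : Z → ℝ}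
    (hV : IsUpperSouslin V) (h0 : ∀ z, 0 ≤ V z) (h1 : ∀ z, V z ≤ 1) (κ : Kernel W Z)
    [IsMarkovKernel κ] : IsUpperSouslin fun w => ∫ z, V z ∂κ w := by
  -- The integral is the area under the graph: the mass of this region for the kernel times Lebesgue
  -- measure on `[0, 1]`.
  let S : Set (Z × ℝ) := regionBetween 0 V univ
  have hS : IsSouslin S := by
    have := IsSouslin.inter hV (measurableSet_lt (measurable_const (a := (0 : ℝ)))
      (measurable_snd (α := Z) (β := ℝ))).isSouslin
    refine cast (congrArg IsSouslin ?_) this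
    ext ⟨z, t⟩
    simp [S, regionBetween, and_comm]
  refine cast (congrArg IsSouslin (Set.ext fun ⟨w, t⟩ => Iff.symm ?_))
    (hS.hypograph_kernel (κ ×ₖ Kernel.const W (volume.restrict (Icc (0 : ℝ) 1))))
  have hsub : S ⊆ univ ×ˢ Icc (0 : ℝ) 1 := fun p hp =>
    ⟨mem_univ _, hp.2.1.le, hp.2.2.le.trans (h1 _)⟩
  have hint : Integrable V (κ w) :=
    Integrable.of_bound (hV.aemeasurable _).aestronglyMeasurable 1
      (.of_forall fun z => by rw [Real.norm_of_nonneg (h0 z)]; exact h1 z)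
  have hval : ((κ ×ₖ Kernel.const W (volume.restrict (Icc (0 : ℝ) 1))) w) S
      = ENNReal.ofReal (∫ z, V z ∂κ w) := by
    rw [Kernel.prod_apply, Kernel.const_apply, ← Measure.restrict_univ (μ := κ w),
      Measure.prod_restrict, Measure.restrict_eq_self _ hsub,
      volume_regionBetween_eq_integral' (integrable_zero _ _ _).integrableOn hint.integrableOn
        .univ (.of_forall fun z => h0 z)]
    simp
  simp only [mem_ofPred_eq, hval, ENNReal.toReal_ofReal (integral_nonneg h0)]

open MeasurableSpace in
/-- Almost sure measurable selection of points at which an upper Souslin function exceeds a given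
level. -/
theorem IsUpperSouslin.exists_selector [CountablyGenerated Z] [StandardBorelSpace W] [Nonempty W]
    {g : Z × W → ℝ} (hg : IsUpperSouslin g) (ν : Measure Z) [IsFiniteMeasure ν] {M : Z → ℝ}
    (hM : AEMeasurable M ν) (hex : ∀ z, ∃ w, M z ≤ g (z, w)) :
    ∃ f : Z → W, Measurable f ∧ ∀ᵐ z ∂ν, M z ≤ g (z, f z) := by
  obtain ⟨M', hM', hMM'⟩ := hM
  -- Only strict superlevel sets are known to be Souslin; a countable intersection gives the
  -- non-strict one, so exact optimizers can be selected.
  have hS : IsSouslin (⋂ n : ℕ, {p : Z × W | M' p.1 - 1 / ((n : ℝ) + 1) < g p}) :=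
    .iInter fun n => hg.isSouslin_lt_comp measurable_id (by fun_prop)
  have hmem : ∀ p, p ∈ (⋂ n : ℕ, {p : Z × W | M' p.1 - 1 / ((n : ℝ) + 1) < g p}) ↔
      M' p.1 ≤ g p := by
    intro p
    simp only [mem_iInter, mem_ofPred_eq]
    constructor
    · intro h
      have hl : Tendsto (fun n : ℕ => M' p.1 - 1 / ((n : ℝ) + 1)) atTop (𝓝 (M' p.1 - 0)) :=
        tendsto_const_nhds.sub tendsto_one_div_add_atTop_nhds_zero_nat
      rw [sub_zero] at hl
      exact le_of_tendsto' hl fun n => (h n).le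
    · intro h n
      have : 0 < 1 / ((n : ℝ) + 1) := by positivity
      linarith
  obtain ⟨f, hf, hfS⟩ := hS.exists_selector ν (by
    filter_upwards [hMM'] with z hz
    obtain ⟨w, hw⟩ := hex z
    exact ⟨w, (hmem _).2 (hz ▸ hw)⟩)
  refine ⟨f, hf, ?_⟩
  filter_upwards [hfS, hMM'] with z hz hz'
  rw [hz']
  exact (hmem _).1 hz

end Selection

/-! ### One-step optima, policies built from selectors, and the verification inequalities. -/

section DynamicProgramming

/-- Compact superlevel sets are closed, so `g` is upper semicontinuous; its maximum over one
nonempty superlevel set is global. -/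
theorem isGreatest_iSup_of_isCompact_le {U : Type*} [TopologicalSpace U] [T2Space U] [Nonempty U]
    {g : U → ℝ} (hg : ∀ r, IsCompact {u | r ≤ g u}) : IsGreatest (range g) (⨆ u, g u) := by
  obtain ⟨u₀⟩ := ‹Nonempty U›
  have husc : UpperSemicontinuous g :=
    upperSemicontinuous_iff_isClosed_preimage.2 fun r => (hg r).isClosed
  obtain ⟨u, hu, hmax⟩ := husc.upperSemicontinuousOn _ |>.exists_isMaxOn ⟨u₀, le_refl (g u₀)⟩
    (hg (g u₀))
  have hub : ∀ v, g v ≤ g u := fun v =>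
    (le_total (g u₀) (g v)).elim (fun h => hmax h) fun h => h.trans hu
  have : Nonempty U := ⟨u₀⟩
  have heq : ⨆ v, g v = g u :=
    le_antisymm (ciSup_le hub) (le_ciSup ⟨g u, forall_mem_range.2 hub⟩ u)
  exact heq ▸ ⟨mem_range_self u, forall_mem_range.2 hub⟩

theorem isLeast_iInf_of_isCompact_le {U : Type*} [TopologicalSpace U] [T2Space U] [Nonempty U]
    {g : U → ℝ} (hg : ∀ r, IsCompact {u | g u ≤ r}) : IsLeast (range g) (⨅ u, g u) := by
  obtain ⟨⟨u, hu⟩, hub⟩ := isGreatest_iSup_of_isCompact_le (g := fun u => -g u) fun r => by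
    simpa only [le_neg] using hg (-r)
  have hlb : ∀ v, g u ≤ g v := fun v => neg_le_neg_iff.1 ((hub ⟨v, rfl⟩ : -g v ≤ _).trans_eq hu.symm)
  have heq : ⨅ v, g v = g u :=
    le_antisymm (ciInf_le ⟨g u, forall_mem_range.2 hlb⟩ u) (le_ciInf hlb)
  exact heq ▸ ⟨mem_range_self u, forall_mem_range.2 hlb⟩

variable {X U : Type*} [MeasurableSpace X] [MeasurableSpace U]

theorem trajLaw_congr (T : Kernel (X × U) X) {π π' : Policy X U} (k : ℕ) (x : X) (m : ℕ)
    (h : ∀ i < m, π (k + i) = π' (k + i)) : trajLaw T π k x m = trajLaw T π' k x m := by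
  induction m with
  | zero => rfl
  | succ m ih =>
    rw [trajLaw, trajLaw, ih fun i hi => h i (hi.trans m.lt_succ_self), h m m.lt_succ_self]

/-- A state-wise feasible property of actions that has almost sure measurable selections is
satisfied almost surely along the trajectory of some policy. -/
theorem exists_policy_ae [TopologicalSpace U] [SecondCountableTopology U]
    [TopologicalSpace.PseudoMetrizableSpace U] [BorelSpace U] [Nonempty U]
    (T : Kernel (X × U) X) [IsMarkovKernel T] (k : ℕ) (x : X) (M : ℕ) {G : ℕ → X → U → Prop}
    (hG : ∀ m < M, ∀ ν : Measure X, IsProbabilityMeasure ν →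
      ∃ f : X → U, Measurable f ∧ ∀ᵐ y ∂ν, G m y (f y)) :
    ∃ π : Policy X U, ∀ m < M, ∀ᵐ h ∂trajLaw T π k x m,
      G m (h (Fin.last m)) ((π (k + m)).1 (h (Fin.last m))) := by
  induction M with
  | zero =>
    exact ⟨fun _ => ⟨fun _ => Classical.arbitrary U, fun _ _ => measurable_const.nullMeasurable⟩,
      by simp⟩
  | succ M ih =>
    obtain ⟨π, hπ⟩ := ih fun m hm => hG m (hm.trans M.lt_succ_self)
    have hP := isProbabilityMeasure_trajLaw T π k x M
    have hl : Measurable fun h : Fin (M + 1) → X => h (Fin.last M) := measurable_pi_apply _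
    obtain ⟨f, hf, hfG⟩ := hG M M.lt_succ_self _
      (Measure.isProbabilityMeasure_map (μ := trajLaw T π k x M) hl.aemeasurable)
    -- The law of the first `M` steps does not involve the map at time `k + M`, so this change keeps
    -- the law for which `f` was chosen.
    let π' : Policy X U := Function.update π (k + M) ⟨f, fun _ _ => hf.nullMeasurable⟩
    have hne : ∀ i < M, π' (k + i) = π (k + i) := fun i hi =>
      Function.update_of_ne (by omega) _ _
    refine ⟨π', fun m hm => ?_⟩
    rw [trajLaw_congr T k x m fun i hi => hne i (by omega)]
    rcases Nat.lt_succ_iff_lt_or_eq.1 hm with h | rfl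
    · rw [hne m h]
      exact hπ m h
    · have : (π' (k + m)).1 = f := by simp [π']
      rw [this]
      exact ae_of_ae_map hl.aemeasurable hfG

/-- The expectation of `W` at the last state on the event that the trajectory stays in `A`. -/
noncomputable def stageValue (T : Kernel (X × U) X) (A : Set X) (π : Policy X U) (k : ℕ) (x : X)
    (W : X → ℝ) (m : ℕ) : ℝ≥0∞ :=
  ∫⁻ h, {h | ∀ i, h i ∈ A}.indicator (fun h => ENNReal.ofReal (W (h (Fin.last m)))) h
    ∂trajLaw T π k x m

theorem measurableSet_forall_mem {A : Set X} (hA : MeasurableSet A) (m : ℕ) :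
    MeasurableSet {h : Fin m → X | ∀ i, h i ∈ A} := by
  simp only [ofPred_forall]
  exact .iInter fun i => measurable_pi_apply i hA

theorem stageValue_zero [MeasurableSingletonClass X] (T : Kernel (X × U) X) {A : Set X}
    (π : Policy X U) (k : ℕ) (x : X) {W : X → ℝ} (hW : ∀ y ∉ A, W y = 0) :
    stageValue T A π k x W 0 = ENNReal.ofReal (W x) := by
  rw [stageValue, trajLaw, lintegral_dirac]
  by_cases hx : x ∈ A <;> simp [indicator, hx, hW]

theorem stageValue_indicator (T : Kernel (X × U) X) {A : Set X} (hA : MeasurableSet A)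
    (π : Policy X U) (k : ℕ) (x : X) (m : ℕ) :
    stageValue T A π k x (A.indicator fun _ => 1) m = trajLaw T π k x m {h | ∀ i, h i ∈ A} := by
  have : {h : Fin (m + 1) → X | ∀ i, h i ∈ A}.indicator
      (fun h => ENNReal.ofReal (A.indicator (fun _ => (1 : ℝ)) (h (Fin.last m)))) =
      {h | ∀ i, h i ∈ A}.indicator 1 := by
    funext h
    by_cases hh : ∀ i, h i ∈ A
    · simp [indicator, hh]
    · simp [indicator, hh]
  rw [stageValue, this, lintegral_indicator_one (measurableSet_forall_mem hA _)]

variable [TopologicalSpace U] [SecondCountableTopology U]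
    [TopologicalSpace.PseudoMetrizableSpace U] [BorelSpace U] [Nonempty U]

/-- Conditioning on the past: since `W` vanishes off `A`, the constraint on the newest state is
automatic and only the constraint on earlier states remains. -/
theorem stageValue_succ (T : Kernel (X × U) X) [IsMarkovKernel T] {A : Set X}
    (hA : MeasurableSet A) (π : Policy X U) (k : ℕ) (x : X) {W : X → ℝ}
    (hWm : ∀ μ : Measure X, IsFiniteMeasure μ → AEMeasurable W μ)
    (h0 : ∀ y, 0 ≤ W y) (h1 : ∀ y, W y ≤ 1) (hW : ∀ y ∉ A, W y = 0) (m : ℕ) :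
    stageValue T A π k x W (m + 1) = ∫⁻ h, {h | ∀ i, h i ∈ A}.indicator (fun h =>
      ENNReal.ofReal (∫ y, W y ∂T (h (Fin.last m), (π (k + m)).1 (h (Fin.last m))))) h
        ∂trajLaw T π k x m := by
  have hP := isProbabilityMeasure_trajLaw T π k x m
  have hP' := isProbabilityMeasure_trajLaw T π k x (m + 1)
  have haem : ∀ μ : Measure (Fin (m + 1 + 1) → X), IsFiniteMeasure μ →
      AEMeasurable ({h | ∀ i, h i ∈ A}.indicator
        fun h => ENNReal.ofReal (W (h (Fin.last (m + 1))))) μ := by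
    intro μ _
    have hl : Measurable fun h : Fin (m + 1 + 1) → X => h (Fin.last (m + 1)) :=
      measurable_pi_apply _
    exact ((hWm (μ.map fun h => h (Fin.last (m + 1))) inferInstance).comp_aemeasurable
      hl.aemeasurable).ennreal_ofReal.indicator (measurableSet_forall_mem hA _)
  have hb : AEMeasurable ({h | ∀ i, h i ∈ A}.indicator
      fun h => ENNReal.ofReal (W (h (Fin.last (m + 1))))) (trajLaw T π k x (m + 1)) :=
    haem _ inferInstance
  rw [trajLaw] at hb
  rw [stageValue, trajLaw, Measure.lintegral_bind (aemeasurable_step T (π (k + m)) m _) hb]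
  refine lintegral_congr fun h => ?_
  have hsn : Measurable fun y => (Fin.snoc h y : Fin (m + 1 + 1) → X) :=
    (measurable_snoc m).comp (measurable_const.prodMk measurable_id)
  rw [lintegral_map' (haem _ inferInstance) hsn.aemeasurable]
  by_cases hh : ∀ i, h i ∈ A
  · rw [indicator_of_mem (by exact hh), ofReal_integral_eq_lintegral_ofReal _ (.of_forall h0)]
    · refine lintegral_congr fun y => ?_
      by_cases hy : y ∈ A
      · rw [indicator_of_mem]
        · simp
        · intro i
          refine Fin.lastCases ?_ (fun j => ?_) i <;> simp [hh, hy]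
      · rw [indicator_of_notMem]
        · simp [hW y hy]
        · intro hc
          exact hy (by simpa using hc (Fin.last _))
    · exact .of_bound (hWm _ inferInstance).aestronglyMeasurable 1
        (.of_forall fun y => by rw [Real.norm_of_nonneg (h0 y)]; exact h1 y)
  · rw [indicator_of_notMem (by exact hh)]
    refine (lintegral_congr fun y => ?_).trans lintegral_zero
    rw [indicator_of_notMem]
    exact fun hc => hh fun i => by simpa using hc i.castSucc

/-- The properties of a sequence of value functions that do not involve the dynamics. -/
structure IsValueCandidate (A : Set X) (k N : ℕ) (V : ℕ → X → ℝ) : Prop where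
  le : k ≤ N
  aemeasurable : ∀ j, k ≤ j → j ≤ N → ∀ μ : Measure X, IsFiniteMeasure μ → AEMeasurable (V j) μ
  nonneg : ∀ j y, 0 ≤ V j y
  le_one : ∀ j y, V j y ≤ 1
  eq_zero : ∀ j, ∀ y ∉ A, V j y = 0
  terminal : V N = A.indicator fun _ => 1

variable [MeasurableSingletonClass X] {T : Kernel (X × U) X} [IsMarkovKernel T] {A : Set X}
  {π : Policy X U} {k N : ℕ} {x : X} {V : ℕ → X → ℝ}

/-- A candidate that dominates its one-step expectations under `π` dominates the value of `π`. -/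
theorem IsValueCandidate.safeProb_le (hV : IsValueCandidate A k N V) (hA : MeasurableSet A)
    (hstep : ∀ m < N - k, ∀ᵐ h ∂trajLaw T π k x m, h (Fin.last m) ∈ A →
      ∫ y, V (k + m + 1) y ∂T (h (Fin.last m), (π (k + m)).1 (h (Fin.last m)))
        ≤ V (k + m) (h (Fin.last m))) :
    safeProb T A N π k x ≤ V k x := by
  have key : ∀ m ≤ N - k, stageValue T A π k x (V (k + m)) m ≤ ENNReal.ofReal (V k x) := by
    intro m
    induction m with
    | zero => exact fun _ => (stageValue_zero T π k x (hV.eq_zero k)).le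
    | succ m ih =>
      intro hm
      refine le_trans ?_ (ih (by omega))
      rw [← add_assoc, stageValue_succ T hA π k x (hV.aemeasurable _ (by omega) (by omega))
        (hV.nonneg _) (hV.le_one _) (hV.eq_zero _)]
      refine lintegral_mono_ae ?_
      filter_upwards [hstep m (by omega)] with h hh
      exact indicator_le_indicator' fun hmem => ENNReal.ofReal_le_ofReal (hh (hmem _))
  have := key (N - k) le_rfl
  rw [Nat.add_sub_cancel' hV.le, hV.terminal, stageValue_indicator T hA] at this
  exact ENNReal.toReal_le_of_le_ofReal (hV.nonneg k x) this

/-- A candidate dominated by its one-step expectations under `π` is dominated by the value of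
`π`. -/
theorem IsValueCandidate.le_safeProb (hV : IsValueCandidate A k N V) (hA : MeasurableSet A)
    (hstep : ∀ m < N - k, ∀ᵐ h ∂trajLaw T π k x m, h (Fin.last m) ∈ A →
      V (k + m) (h (Fin.last m))
        ≤ ∫ y, V (k + m + 1) y ∂T (h (Fin.last m), (π (k + m)).1 (h (Fin.last m)))) :
    V k x ≤ safeProb T A N π k x := by
  have key : ∀ m ≤ N - k, ENNReal.ofReal (V k x) ≤ stageValue T A π k x (V (k + m)) m := by
    intro m
    induction m with
    | zero => exact fun _ => (stageValue_zero T π k x (hV.eq_zero k)).ge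
    | succ m ih =>
      intro hm
      refine (ih (by omega)).trans ?_
      rw [← add_assoc, stageValue_succ T hA π k x (hV.aemeasurable _ (by omega) (by omega))
        (hV.nonneg _) (hV.le_one _) (hV.eq_zero _)]
      refine lintegral_mono_ae ?_
      filter_upwards [hstep m (by omega)] with h hh
      exact indicator_le_indicator' fun hmem => ENNReal.ofReal_le_ofReal (hh (hmem _))
  have := key (N - k) le_rfl
  rw [Nat.add_sub_cancel' hV.le, hV.terminal, stageValue_indicator T hA] at this
  have hP := isProbabilityMeasure_trajLaw T π k x (N - k)
  exact (ENNReal.ofReal_le_iff_le_toReal (measure_ne_top _ _)).1 this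

end DynamicProgramming

/-! ### Optimal policies, value iteration and identification of the value functions. -/

section Optimality

theorem image_indicator_mul_range {X U : Type*} (A : Set X) (x : X) (g : U → ℝ) :
    (range fun u => A.indicator (fun _ => (1 : ℝ)) x * g u) =
      (fun t => A.indicator (fun _ => (1 : ℝ)) x * t) '' range g :=
  range_comp (fun t => A.indicator (fun _ => (1 : ℝ)) x * t) g

theorem monotone_indicator_mul {X : Type*} (A : Set X) (x : X) :
    Monotone fun t : ℝ => A.indicator (fun _ => (1 : ℝ)) x * t := fun _ _ h =>
  mul_le_mul_of_nonneg_left h (indicator_nonneg (fun _ _ => zero_le_one) x)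

theorem indicator_eq_indicator_mul {X : Type*} (A : Set X) (f : X → ℝ) (x : X) :
    A.indicator f x = A.indicator (fun _ => (1 : ℝ)) x * f x := by
  by_cases hx : x ∈ A <;> simp [hx]

theorem indicator_nonneg_le_one {X : Type*} {A : Set X} {f : X → ℝ} (h : ∀ x, 0 ≤ f x ∧ f x ≤ 1) (x : X) :
    0 ≤ A.indicator f x ∧ A.indicator f x ≤ 1 :=
  ⟨indicator_nonneg (fun y _ => (h y).1) x, indicator_le' (fun y _ => (h y).2)
    (fun _ _ => zero_le_one) x⟩

variable {X U : Type*} [MeasurableSpace X] [MeasurableSpace U]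

theorem integral_nonneg_le_one {μ : Measure X} [IsProbabilityMeasure μ] {V : X → ℝ}
    (h0 : ∀ y, 0 ≤ V y) (h1 : ∀ y, V y ≤ 1) : 0 ≤ ∫ y, V y ∂μ ∧ ∫ y, V y ∂μ ≤ 1 := by
  refine ⟨integral_nonneg h0, ?_⟩
  calc ∫ y, V y ∂μ ≤ ∫ _, (1 : ℝ) ∂μ :=
        integral_mono_of_nonneg (.of_forall h0) (integrable_const 1) (.of_forall h1)
    _ = 1 := by simp

theorem integrable_of_nonneg_le_one {μ : Measure X} [IsFiniteMeasure μ] {V : X → ℝ}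
    (hV : AEMeasurable V μ) (h0 : ∀ y, 0 ≤ V y) (h1 : ∀ y, V y ≤ 1) : Integrable V μ :=
  .of_bound hV.aestronglyMeasurable 1
    (.of_forall fun y => by rw [Real.norm_of_nonneg (h0 y)]; exact h1 y)

section Candidate

variable [MeasurableSpace.CountablyGenerated X] [MeasurableSingletonClass X]
  [TopologicalSpace U] [PolishSpace U] [BorelSpace U] [Nonempty U]
  {T : Kernel (X × U) X} [IsMarkovKernel T] {A : Set X} {k N : ℕ} {V : ℕ → X → ℝ}

theorem IsValueCandidate.isGreatest (hV : IsValueCandidate A k N V) (hA : MeasurableSet A)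
    (hS : ∀ j, k < j → j ≤ N → IsUpperSouslin (V j))
    (hrec : ∀ j, k ≤ j → j < N → ∀ y ∈ A,
      IsGreatest (range fun u : U => ∫ z, V (j + 1) z ∂T (y, u)) (V j y)) (x : X) :
    IsGreatest (range fun π : Policy X U => safeProb T A N π k x) (V k x) := by
  have hub : ∀ π : Policy X U, safeProb T A N π k x ≤ V k x := fun π =>
    hV.safeProb_le hA fun m hm => .of_forall fun h hh =>
      (hrec _ (by omega) (by omega) _ hh).2 ⟨_, rfl⟩
  obtain ⟨π, hπ⟩ := exists_policy_ae T k x (N - k)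
    -- No restriction to `A` is needed: off `A` the left side is zero and every action works.
    (G := fun m y u => V (k + m) y ≤ ∫ z, V (k + m + 1) z ∂T (y, u)) fun m hm ν _ => by
      refine ((hS (k + m + 1) (by omega) (by omega)).integral_kernel (hV.nonneg _) (hV.le_one _)
        T).exists_selector ν (hV.aemeasurable _ (by omega) (by omega) _ inferInstance) fun y => ?_
      by_cases hy : y ∈ A
      · obtain ⟨u, hu⟩ := (hrec (k + m) (by omega) (by omega) y hy).1
        exact ⟨u, hu.ge⟩
      · refine ⟨Classical.arbitrary U, ?_⟩
        rw [hV.eq_zero _ y hy]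
        exact integral_nonneg (hV.nonneg _)
  refine ⟨⟨π, (hub π).antisymm (hV.le_safeProb hA fun m hm => ?_)⟩, forall_mem_range.2 hub⟩
  filter_upwards [hπ m hm] with h hh _ using hh

theorem IsValueCandidate.isLeast (hV : IsValueCandidate A k N V) (hA : MeasurableSet A)
    (hS : ∀ j, k < j → j ≤ N → IsUpperSouslin fun y => 1 - V j y)
    (hrec : ∀ j, k ≤ j → j < N → ∀ y ∈ A,
      IsLeast (range fun u : U => ∫ z, V (j + 1) z ∂T (y, u)) (V j y)) (x : X) :
    IsLeast (range fun π : Policy X U => safeProb T A N π k x) (V k x) := by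
  classical
  have hlb : ∀ π : Policy X U, V k x ≤ safeProb T A N π k x := fun π =>
    hV.le_safeProb hA fun m hm => .of_forall fun h hh =>
      (hrec _ (by omega) (by omega) _ hh).2 ⟨_, rfl⟩
  obtain ⟨π, hπ⟩ := exists_policy_ae T k x (N - k)
    (G := fun m y u => y ∈ A → ∫ z, V (k + m + 1) z ∂T (y, u) ≤ V (k + m) y) fun m hm ν _ => by
      have hint : ∀ p, ∫ z, (1 - V (k + m + 1) z) ∂T p = 1 - ∫ z, V (k + m + 1) z ∂T p := by
        intro p
        rw [integral_sub (integrable_const 1) (integrable_of_nonneg_le_one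
          (hV.aemeasurable _ (by omega) (by omega) _ inferInstance) (hV.nonneg _) (hV.le_one _))]
        simp
      -- Minimizing `V` is maximizing `1 - V`. Off `A` the recursion is not available and `1 - V`
      -- would demand the level one, so the level is lowered to zero there.
      have hM : AEMeasurable (A.indicator fun y => 1 - V (k + m) y) ν :=
        ((hV.aemeasurable _ (by omega) (by omega) _ inferInstance).const_sub 1).indicator hA
      obtain ⟨f, hf, hfM⟩ := ((hS (k + m + 1) (by omega) (by omega)).integral_kernel
        (fun y => sub_nonneg.2 (hV.le_one _ y)) (fun y => sub_le_self _ (hV.nonneg _ y))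
        T).exists_selector ν hM fun y => by
          by_cases hy : y ∈ A
          · obtain ⟨u, hu⟩ := (hrec (k + m) (by omega) (by omega) y hy).1
            refine ⟨u, ?_⟩
            rw [indicator_of_mem hy, hint, ← hu]
          · refine ⟨Classical.arbitrary U, ?_⟩
            rw [indicator_of_notMem hy]
            exact integral_nonneg fun y => sub_nonneg.2 (hV.le_one _ y)
      refine ⟨f, hf, ?_⟩
      filter_upwards [hfM] with y hy hyA
      rw [indicator_of_mem hyA, hint] at hy
      linarith
  exact ⟨⟨π, (hV.safeProb_le hA hπ).antisymm (hlb π)⟩, forall_mem_range.2 hlb⟩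

end Candidate

/-- The maximum invariance value with `m` steps to go, computed by dynamic programming. -/
noncomputable def maxVal (T : Kernel (X × U) X) (A : Set X) : ℕ → X → ℝ
  | 0 => A.indicator fun _ => 1
  | m + 1 => A.indicator fun x => ⨆ u, ∫ y, maxVal T A m y ∂T (x, u)

/-- The minimum invariance value with `m` steps to go, computed by dynamic programming. -/
noncomputable def minVal (T : Kernel (X × U) X) (A : Set X) : ℕ → X → ℝ
  | 0 => A.indicator fun _ => 1
  | m + 1 => A.indicator fun x => ⨅ u, ∫ y, minVal T A m y ∂T (x, u)

theorem maxVal_mem [Nonempty U] (T : Kernel (X × U) X) [IsMarkovKernel T] (A : Set X) (m : ℕ) :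
    ∀ x, 0 ≤ maxVal T A m x ∧ maxVal T A m x ≤ 1 := by
  induction m with
  | zero => exact indicator_nonneg_le_one fun _ => ⟨zero_le_one, le_rfl⟩
  | succ m ih =>
    have h := fun p => integral_nonneg_le_one (μ := T p) (fun y => (ih y).1) fun y => (ih y).2
    exact indicator_nonneg_le_one fun x =>
      ⟨Real.iSup_nonneg fun u => (h (x, u)).1, ciSup_le fun u => (h (x, u)).2⟩

theorem minVal_mem [Nonempty U] (T : Kernel (X × U) X) [IsMarkovKernel T] (A : Set X) (m : ℕ) :
    ∀ x, 0 ≤ minVal T A m x ∧ minVal T A m x ≤ 1 := by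
  induction m with
  | zero => exact indicator_nonneg_le_one fun _ => ⟨zero_le_one, le_rfl⟩
  | succ m ih =>
    have h := fun p => integral_nonneg_le_one (μ := T p) (fun y => (ih y).1) fun y => (ih y).2
    refine indicator_nonneg_le_one fun x => ⟨Real.iInf_nonneg fun u => (h (x, u)).1, ?_⟩
    obtain ⟨u⟩ := ‹Nonempty U›
    exact (ciInf_le ⟨0, forall_mem_range.2 fun u => (h (x, u)).1⟩ u).trans (h (x, u)).2

theorem maxVal_eq_zero (T : Kernel (X × U) X) {A : Set X} (m : ℕ) {x : X} (hx : x ∉ A) :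
    maxVal T A m x = 0 := by
  cases m <;> exact indicator_of_notMem hx _

theorem minVal_eq_zero (T : Kernel (X × U) X) {A : Set X} (m : ℕ) {x : X} (hx : x ∉ A) :
    minVal T A m x = 0 := by
  cases m <;> exact indicator_of_notMem hx _

/-- Attainability transfers to the iterate once the two value functions agree with `m` steps to go;
it is used at time `N - m - 1`. -/
theorem isGreatest_integral_maxVal [TopologicalSpace U] [T2Space U] [Nonempty U]
    {T : Kernel (X × U) X} {A : Set X} {N : ℕ} (hatt : Attainable T A N) {m : ℕ} (hm : m < N)
    (h : maxInv T A N (N - m) = maxVal T A m) (x : X) :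
    IsGreatest (range fun u : U => ∫ y, maxVal T A m y ∂T (x, u))
      (⨆ u, ∫ y, maxVal T A m y ∂T (x, u)) :=
  isGreatest_iSup_of_isCompact_le fun r => by
    have := (hatt (N - m - 1) (by omega) x r).1
    rwa [show N - m - 1 + 1 = N - m by omega, h] at this

theorem isLeast_integral_minVal [TopologicalSpace U] [T2Space U] [Nonempty U]
    {T : Kernel (X × U) X} {A : Set X} {N : ℕ} (hatt : Attainable T A N) {m : ℕ} (hm : m < N)
    (h : minInv T A N (N - m) = minVal T A m) (x : X) :
    IsLeast (range fun u : U => ∫ y, minVal T A m y ∂T (x, u))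
      (⨅ u, ∫ y, minVal T A m y ∂T (x, u)) :=
  isLeast_iInf_of_isCompact_le fun r => by
    have := (hatt (N - m - 1) (by omega) x r).2
    rwa [show N - m - 1 + 1 = N - m by omega, h] at this

variable [MeasurableSpace.CountablyGenerated X] [MeasurableSingletonClass X]
  [TopologicalSpace U] [PolishSpace U] [BorelSpace U] [Nonempty U]
  {T : Kernel (X × U) X} [IsMarkovKernel T] {A : Set X} {N : ℕ}

theorem maxVal_spec (hA : MeasurableSet A) (hatt : Attainable T A N) (m : ℕ) (hm : m ≤ N) :
    IsUpperSouslin (maxVal T A m) ∧ ∀ x, IsGreatest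
      (range fun π : Policy X U => safeProb T A N π (N - m) x) (maxVal T A m x) := by
  classical
  induction m using Nat.strong_induction_on with
  | _ m ih =>
  have heq : ∀ i < m, maxInv T A N (N - i) = maxVal T A i := fun i hi =>
    funext fun x => ((ih i hi (by omega)).2 x).csSup_eq
  have hup : IsUpperSouslin (maxVal T A m) := by
    cases m with
    | zero => exact (measurable_const.indicator hA).isUpperSouslin
    | succ i =>
      refine cast (congrArg IsUpperSouslin (funext fun x => ?_))
        (((((ih i i.lt_succ_self (by omega)).1.integral_kernel (fun y => (maxVal_mem T A i y).1)
          (fun y => (maxVal_mem T A i y).2) T).of_isGreatest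
            (isGreatest_integral_maxVal hatt (by omega) (heq i i.lt_succ_self)))).ite hA 0)
      simp [maxVal, indicator]
  have hup' : ∀ i ≤ m, IsUpperSouslin (maxVal T A i) := fun i hi => by
    rcases hi.lt_or_eq with h | rfl
    · exact (ih i h (by omega)).1
    · exact hup
  -- Time is reversed: the candidate at time `j` has `N - j` steps to go.
  have hV : IsValueCandidate A (N - m) N fun j => maxVal T A (N - j) :=
    { le := by omega
      aemeasurable := fun j h1 h2 μ _ => (hup' (N - j) (by omega)).aemeasurable μ
      nonneg := fun j y => (maxVal_mem T A _ y).1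
      le_one := fun j y => (maxVal_mem T A _ y).2
      eq_zero := fun j y hy => maxVal_eq_zero T _ hy
      terminal := by simp [maxVal] }
  refine ⟨hup, fun x => ?_⟩
  have hres := hV.isGreatest (T := T) hA (fun j h1 h2 => hup' (N - j) (by omega))
    (fun j h1 h2 y hy => by
      obtain ⟨i, hi⟩ : ∃ i, N - j = i + 1 := ⟨N - j - 1, by omega⟩
      have hi' : N - (j + 1) = i := by omega
      simp only [hi, hi', maxVal, indicator_of_mem hy]
      exact isGreatest_integral_maxVal hatt (by omega) (heq i (by omega)) y) x
  simpa only [Nat.sub_sub_self hm] using hres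

/-- The Souslin property is carried by `1 - minVal` because projection preserves suprema, not
infima, of upper Souslin functions. -/
theorem minVal_spec (hA : MeasurableSet A) (hatt : Attainable T A N) (m : ℕ) (hm : m ≤ N) :
    IsUpperSouslin (fun y => 1 - minVal T A m y) ∧ ∀ x, IsLeast
      (range fun π : Policy X U => safeProb T A N π (N - m) x) (minVal T A m x) := by
  classical
  induction m using Nat.strong_induction_on with
  | _ m ih =>
  have heq : ∀ i < m, minInv T A N (N - i) = minVal T A i := fun i hi =>
    funext fun x => ((ih i hi (by omega)).2 x).csInf_eq
  have haem : ∀ i, IsUpperSouslin (fun y => 1 - minVal T A i y) → ∀ μ : Measure X,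
      IsFiniteMeasure μ → AEMeasurable (minVal T A i) μ := fun i hi μ _ => by
    simpa using (hi.aemeasurable μ).const_sub 1
  have hup : IsUpperSouslin fun y => 1 - minVal T A m y := by
    cases m with
    | zero => exact ((measurable_const.indicator hA).const_sub 1).isUpperSouslin
    | succ i =>
      have hi := (ih i i.lt_succ_self (by omega)).1
      have hint : ∀ p, ∫ y, (1 - minVal T A i y) ∂T p = 1 - ∫ y, minVal T A i y ∂T p := by
        intro p
        rw [integral_sub (integrable_const 1) (integrable_of_nonneg_le_one
          (haem i hi _ inferInstance) (fun y => (minVal_mem T A i y).1)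
          fun y => (minVal_mem T A i y).2)]
        simp
      have hgr : ∀ x, IsGreatest (range fun u : U => ∫ y, (1 - minVal T A i y) ∂T (x, u))
          (1 - ⨅ u, ∫ y, minVal T A i y ∂T (x, u)) := by
        intro x
        obtain ⟨⟨u, hu⟩, hlb⟩ :=
          isLeast_integral_minVal hatt (by omega) (heq i i.lt_succ_self) x
        refine ⟨⟨u, ?_⟩, forall_mem_range.2 fun v => ?_⟩
        · simp only [hint, ← hu]
        · rw [hint]
          exact sub_le_sub_left (hlb ⟨v, rfl⟩) 1
      -- The default value off `A` is one here, since `minVal` vanishes there.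
      refine cast (congrArg IsUpperSouslin (funext fun x => ?_))
        (((hi.integral_kernel (fun y => sub_nonneg.2 (minVal_mem T A i y).2)
          (fun y => sub_le_self _ (minVal_mem T A i y).1) T).of_isGreatest hgr).ite hA 1)
      by_cases hx : x ∈ A <;> simp [minVal, hx]
  have hup' : ∀ i ≤ m, IsUpperSouslin fun y => 1 - minVal T A i y := fun i hi => by
    rcases hi.lt_or_eq with h | rfl
    · exact (ih i h (by omega)).1
    · exact hup
  have hV : IsValueCandidate A (N - m) N fun j => minVal T A (N - j) :=
    { le := by omega
      aemeasurable := fun j h1 h2 => haem _ (hup' (N - j) (by omega))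
      nonneg := fun j y => (minVal_mem T A _ y).1
      le_one := fun j y => (minVal_mem T A _ y).2
      eq_zero := fun j y hy => minVal_eq_zero T _ hy
      terminal := by simp [minVal] }
  refine ⟨hup, fun x => ?_⟩
  have hres := hV.isLeast (T := T) hA (fun j h1 h2 => hup' (N - j) (by omega))
    (fun j h1 h2 y hy => by
      obtain ⟨i, hi⟩ : ∃ i, N - j = i + 1 := ⟨N - j - 1, by omega⟩
      have hi' : N - (j + 1) = i := by omega
      simp only [hi, hi', minVal, indicator_of_mem hy]
      exact isLeast_integral_minVal hatt (by omega) (heq i (by omega)) y) x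
  simpa only [Nat.sub_sub_self hm] using hres

theorem maxInv_eq_maxVal (hA : MeasurableSet A) (hatt : Attainable T A N) {k : ℕ} (hk : k ≤ N) :
    maxInv T A N k = maxVal T A (N - k) := by
  funext x
  have := ((maxVal_spec hA hatt (N - k) (Nat.sub_le _ _)).2 x).csSup_eq
  rwa [Nat.sub_sub_self hk] at this

theorem minInv_eq_minVal (hA : MeasurableSet A) (hatt : Attainable T A N) {k : ℕ} (hk : k ≤ N) :
    minInv T A N k = minVal T A (N - k) := by
  funext x
  have := ((minVal_spec hA hatt (N - k) (Nat.sub_le _ _)).2 x).csInf_eq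
  rwa [Nat.sub_sub_self hk] at this

theorem isGreatest_maxInv (hA : MeasurableSet A) (hatt : Attainable T A N) {k : ℕ} (hk : k < N)
    (x : X) : IsGreatest (range fun u : U => A.indicator (fun _ => (1 : ℝ)) x *
      ∫ y, maxInv T A N (k + 1) y ∂T (x, u)) (maxInv T A N k x) := by
  obtain ⟨i, hi⟩ : ∃ i, N - k = i + 1 := ⟨N - k - 1, by omega⟩
  have hi' : N - (k + 1) = i := by omega
  have hN : N - i = k + 1 := by omega
  have h1 := maxInv_eq_maxVal hA hatt (k := k + 1) hk
  rw [maxInv_eq_maxVal hA hatt hk.le, h1, hi, hi', maxVal, image_indicator_mul_range,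
    indicator_eq_indicator_mul A fun x => ⨆ u, ∫ y, maxVal T A i y ∂T (x, u)]
  exact (monotone_indicator_mul A x).map_isGreatest
    (isGreatest_integral_maxVal hatt (m := i) (by omega) (by rw [hN, h1, hi']) x)

theorem isLeast_minInv (hA : MeasurableSet A) (hatt : Attainable T A N) {k : ℕ} (hk : k < N)
    (x : X) : IsLeast (range fun u : U => A.indicator (fun _ => (1 : ℝ)) x *
      ∫ y, minInv T A N (k + 1) y ∂T (x, u)) (minInv T A N k x) := by
  obtain ⟨i, hi⟩ : ∃ i, N - k = i + 1 := ⟨N - k - 1, by omega⟩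
  have hi' : N - (k + 1) = i := by omega
  have hN : N - i = k + 1 := by omega
  have h1 := minInv_eq_minVal hA hatt (k := k + 1) hk
  rw [minInv_eq_minVal hA hatt hk.le, h1, hi, hi', minVal, image_indicator_mul_range,
    indicator_eq_indicator_mul A fun x => ⨅ u, ∫ y, minVal T A i y ∂T (x, u)]
  exact (monotone_indicator_mul A x).map_isLeast
    (isLeast_integral_minVal hatt (m := i) (by omega) (by rw [hN, h1, hi']) x)

end Optimality

end StochSafety

theorem mainTheorem3 {n m : ℕ} (X : Set (EuclideanSpace ℝ (Fin n)))
    (U : Set (EuclideanSpace ℝ (Fin m))) (hU : IsCompact U) (hU_ne : U.Nonempty)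
    (T : ProbabilityTheory.Kernel (X × U) X) [ProbabilityTheory.IsMarkovKernel T]
    (A : Set X) (hA : MeasurableSet A) (N : ℕ) (hatt : StochSafety.Attainable T A N) :
    -- the maximum and the minimum over Markov policies are attained
    (∀ k ≤ N, ∀ x : X,
      IsGreatest (Set.range fun π : StochSafety.Policy X U => StochSafety.safeProb T A N π k x)
        (StochSafety.maxInv T A N k x) ∧
      IsLeast (Set.range fun π : StochSafety.Policy X U => StochSafety.safeProb T A N π k x)
        (StochSafety.minInv T A N k x)) ∧
    -- the integrals in the recursions are well defined
    (∀ k < N, ∀ (x : X) (u : U),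
      MeasureTheory.Integrable (StochSafety.maxInv T A N (k + 1)) (T (x, u)) ∧
      MeasureTheory.Integrable (StochSafety.minInv T A N (k + 1)) (T (x, u))) ∧
    -- recursion for maximum invariance
    ((∀ x : X, StochSafety.maxInv T A N N x = A.indicator (fun _ => (1 : ℝ)) x) ∧
      ∀ k < N, ∀ x : X,
        IsGreatest (Set.range fun u : U => A.indicator (fun _ => (1 : ℝ)) x *
            ∫ y, StochSafety.maxInv T A N (k + 1) y ∂(T (x, u)))
          (StochSafety.maxInv T A N k x)) ∧
    -- recursion for minimum invariance
    ((∀ x : X, StochSafety.minInv T A N N x = A.indicator (fun _ => (1 : ℝ)) x) ∧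
      ∀ k < N, ∀ x : X,
        IsLeast (Set.range fun u : U => A.indicator (fun _ => (1 : ℝ)) x *
            ∫ y, StochSafety.minInv T A N (k + 1) y ∂(T (x, u)))
          (StochSafety.minInv T A N k x)) := by
  have : Nonempty U := hU_ne.to_subtype
  have : PolishSpace U := hU.isClosed.polishSpace
  refine ⟨fun k hk x => ?_, fun k hk x u => ?_, ⟨fun x => ?_, fun k hk x => ?_⟩,
    fun x => ?_, fun k hk x => ?_⟩
  · have hmax := (StochSafety.maxVal_spec hA hatt (N - k) (Nat.sub_le _ _)).2 x
    have hmin := (StochSafety.minVal_spec hA hatt (N - k) (Nat.sub_le _ _)).2 x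
    rw [Nat.sub_sub_self hk] at hmax hmin
    rw [StochSafety.maxInv_eq_maxVal hA hatt hk, StochSafety.minInv_eq_minVal hA hatt hk]
    exact ⟨hmax, hmin⟩
  · rw [StochSafety.maxInv_eq_maxVal hA hatt hk, StochSafety.minInv_eq_minVal hA hatt hk]
    have hmax := (StochSafety.maxVal_spec hA hatt (N - (k + 1)) (Nat.sub_le _ _)).1.aemeasurable
      (T (x, u))
    have hmin := (StochSafety.minVal_spec hA hatt (N - (k + 1)) (Nat.sub_le _ _)).1.aemeasurable
      (T (x, u))
    refine ⟨StochSafety.integrable_of_nonneg_le_one hmax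
      (fun y => (StochSafety.maxVal_mem T A _ y).1) fun y => (StochSafety.maxVal_mem T A _ y).2,
      StochSafety.integrable_of_nonneg_le_one (by simpa using hmin.const_sub 1)
      (fun y => (StochSafety.minVal_mem T A _ y).1) fun y => (StochSafety.minVal_mem T A _ y).2⟩
  · rw [StochSafety.maxInv_eq_maxVal hA hatt le_rfl, Nat.sub_self, StochSafety.maxVal]
  · exact StochSafety.isGreatest_maxInv hA hatt hk x
  · rw [StochSafety.minInv_eq_minVal hA hatt le_rfl, Nat.sub_self, StochSafety.minVal]
  · exact StochSafety.isLeast_minInv hA hatt hk x
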